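/- **Setting.** A *strict inverse category* is a category $\mathcal N$ with a function $\deg:\mathrm{ob}\,\mathcal N\to\mathbb N$ such that $\deg i>\deg j$ for every non-isomorphism $i\to j$, isomorphic objects have equal degree, and every isomorphism is an identity. An *iterated gluing diagram* $(\mathcal N,\mathcal I,\partial\mathcal I,\mathcal I^\circ)$ consists of: * a small strict inverse category $\mathcal N$, a functor $\mathcal I:\mathcal N^{\mathrm{op}}\to\mathbf{Cat}$ and small categories $\partial\mathcal I_n$ for $n\in\mathcal N$; * for each $n\in\mathcal N$, a functor $\mathcal I^\circ_n:(\partial\mathcal I_n)^{\mathrm{op}}\times\mathcal I_{<n}\to\mathbf{Set}$, where $\mathcal I_{<n}=\mathcal N(n,-)^\circ\otimes_{\mathcal N^{\mathrm{op}}}\mathcal I$ is the colimit of $\mathcal I$ weighted by $\mathcal N(n,-)$ with the identity removed (equivalently, the colimit in $\mathbf{Cat}$ of the $\mathcal I_m$ over all non-identity maps $n\to m$); such that $\mathcal I_n$ is (isomorphic to) the collage of $\mathcal I^\circ_n$: its objects are those of $\mathcal I_{<n}$ and of $\partial\mathcal I_n$, both as full subcategories, with $\mathcal I_n(i,j)=\mathcal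 I_n^\circ(i,j)$ and $\mathcal I_n(j,i)=\emptyset$ for $i\in\partial\mathcal I_n$, $j\in\mathcal I_{<n}$, and for each non-identity $\alpha:n\to m$ the functor $\mathcal I_\alpha$ is the colimiting leg $\mathcal I_m\to\mathcal I_{<n}$ followed by the inclusion $\mathcal I_{<n}\hookrightarrow\mathcal I_n$. Put $\mathcal I_\infty=\operatorname{colim}_{n}\mathcal I_n$, and write $[i]_n\in\mathcal I_\infty$ for the image of $i\in\partial\mathcal I_n$. Let $\mathcal E$ be a (locally small) category with finite limits and with all limits indexed by the categories of elements $\oint_{j\in\mathcal I_{<n}}\mathcal I_n^\circ(i,j)$, for $n\in\mathcal N$ and $i\in\partial\mathcal I_n$. Let $\mathrm{res}_{<n}:\mathcal E^{\mathcal I_n}\to\mathcal E^{\mathcal I_{<n}}$ be restriction, $\mathrm{cosk}_n$ its right adjoint (right Kan extension), and $t_n:\partial\mathcal I_n\hookrightarrow\mathcal I_n$ the inclusion. The matching object functor is $M_n=t_n^*\,\mathrm{cosk}_n:\mathcal E^{\mathcal I_{<n}}\to\mathcal E^{\partial\mathcal I_n}$, and the matching map $m_n:t_n^*\to M_n\,\mathrm{res}_{<n}$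 is $t_n^*$ applied to the unit of $\mathrm{res}_{<n}\dashv\mathrm{cosk}_n$. For $X\in\mathcal E^{\mathcal I_\infty}$, write $X|_{=n}\in\mathcal E^{\partial\mathcal I_n}$ for its restriction, $M_nX$ for $M_n$ applied to the restriction of $X$ to $\mathcal I_{<n}$, and $M_iX=(M_nX)(i)$, $m_i:X[i]_n\to M_iX$ for $i\in\partial\mathcal I_n$. **Theorem.** Suppose that each $\mathcal E^{\partial\mathcal I_n}$ is equipped with a subobject classifier $\overline{\mathrm{true}}_n:1\to\overline\Omega_n$, and let $\wedge:\overline\Omega_n\times\overline\Omega_n\to\overline\Omega_n$ be the characteristic map of $(\overline{\mathrm{true}}_n,\overline{\mathrm{true}}_n)$. Then $\mathcal E^{\mathcal I_\infty}$ has a subobject classifier $\mathrm{true}_\infty:1\to\Omega_\infty$, and there are maps $p_n:\Omega_\infty|_{=n}\to\overline\Omega_n$ in $\mathcal E^{\partial\mathcal I_n}$ $(n\in\mathcal N)$, such that for all $n\in\mathcal N$ and $i\in\partial\mathcal I_n$: 1. the map $e_i=((p_n)_i,m_i):\Omega_\infty[i]_n\to\overline\Omega_n i\times M_i\Omega_\infty$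 is an equaliser in $\mathcal E$ of $$\pi_1,\ \wedge_i\circ\bigl(\mathrm{id}\times(\chi_{M_n(\mathrm{true}_\infty)})_i\bigr)\ :\ \overline\Omega_n i\times M_i\Omega_\infty\rightrightarrows\overline\Omega_n i,$$ where $\chi_{M_n(\mathrm{true}_\infty)}:M_n\Omega_\infty\to\overline\Omega_n$ is the characteristic map of the monomorphism $M_n(\mathrm{true}_\infty):M_n1\cong1\hookrightarrow M_n\Omega_\infty$ in $\mathcal E^{\partial\mathcal I_n}$; 2. $\pi_1\circ e_i\circ(\mathrm{true}_\infty)_{[i]_n}=(\overline{\mathrm{true}}_n)_i$ and $\pi_2\circ e_i\circ(\mathrm{true}_\infty)_{[i]_n}=M_i(\mathrm{true}_\infty)$, up to the canonical identifications of the terminal objects $1$, $\overline 1$ and $M_i1$. -/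

import Mathlib

open CategoryTheory CategoryTheory.Limits Opposite

universe w u v

/-! ### Inverse categories -/

/-- `IsIdentity f` says that the morphism `f` is an identity. -/
inductive IsIdentity {C : Type u} [Category.{v} C] : ∀ {X Y : C}, (X ⟶ Y) → Prop
  | id (X : C) : IsIdentity (𝟙 X)

/-- A generalised inverse structure on a category: a degree function which is strictly lowered
by non-isomorphisms and preserved by isomorphisms. -/
class GeneralisedInverseStructure (N : Type u) [Category.{v} N] where
  deg : N → ℕ
  deg_lt : ∀ {i j : N} (f : i ⟶ j), ¬ IsIso f → deg j < deg i
  deg_eq : ∀ {i j : N} (f : i ⟶ j), IsIso f → deg i = deg j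

/-- A strict inverse structure: all isomorphisms are identities. -/
class StrictInverseStructure (N : Type u) [Category.{v} N] extends
    GeneralisedInverseStructure N where
  isIdentity_of_isIso : ∀ {i j : N} (f : i ⟶ j), IsIso f → IsIdentity f

lemma IsIdentity.isIso {C : Type u} [Category.{v} C] {X Y : C} {f : X ⟶ Y}
    (h : IsIdentity f) : IsIso f := by
  cases h; infer_instance

/-- In a strict inverse category, anything composed with a non-identity is a non-identity. -/
lemma not_isIdentity_comp {N : Type u} [Category.{v} N] [StrictInverseStructure N] {i j k : N}
    (f : i ⟶ j) (g : j ⟶ k) (hf : ¬ IsIdentity f) : ¬ IsIdentity (f ≫ g) := by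
  intro h
  have h1 : GeneralisedInverseStructure.deg j < GeneralisedInverseStructure.deg i :=
    GeneralisedInverseStructure.deg_lt f
      (fun hi => hf (StrictInverseStructure.isIdentity_of_isIso f hi))
  have h2 : GeneralisedInverseStructure.deg k ≤ GeneralisedInverseStructure.deg j := by
    by_cases hg : IsIso g
    · exact (GeneralisedInverseStructure.deg_eq g hg).ge
    · exact (GeneralisedInverseStructure.deg_lt g hg).le
  have h3 : GeneralisedInverseStructure.deg i = GeneralisedInverseStructure.deg k :=
    GeneralisedInverseStructure.deg_eq (f ≫ g) h.isIso
  omega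

/-- The functor `N(n, -)°`, i.e. `N(n, -)` with the identity removed. -/
def properHom {N : Type w} [SmallCategory N] [StrictInverseStructure N] (n : N) :
    N ⥤ Type w where
  obj m := { f : n ⟶ m // ¬ IsIdentity f }
  map g := TypeCat.ofHom (fun f => ⟨f.1 ≫ g, not_isIdentity_comp f.1 g f.2⟩)

/-! ### Collages -/

/-- The objects of the collage of a profunctor `H` from `C` to `D` (so that `H` is covariant in
`C` and contravariant in `D`): the disjoint union of those of `C` and of `D`. -/
inductive Collage {C : Type u} [Category.{w} C] {D : Type u} [Category.{w} D]
    (H : Profunctor.{w} C D) : Type u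
  | ofC (c : C) : Collage H
  | ofD (d : D) : Collage H

namespace Collage

variable {C : Type u} [Category.{w} C] {D : Type u} [Category.{w} D] (H : Profunctor.{w} C D)

/-- The maps of the collage: those of `C`, those of `D`, and the elements of `H(d, c)` as maps
from `d` to `c`. There are no maps from objects of `C` to objects of `D`. -/
protected def Hom : Collage H → Collage H → Type w
  | .ofC c, .ofC c' => c ⟶ c'
  | .ofC _, .ofD _ => PEmpty
  | .ofD d, .ofC c => (H.obj c).obj (op d)
  | .ofD d, .ofD d' => d ⟶ d'

/-- Composition in the collage is given by those of `C` and `D` and the functoriality of `H`. -/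
protected def comp : ∀ {X Y Z : Collage H}, Collage.Hom H X Y → Collage.Hom H Y Z →
    Collage.Hom H X Z
  | .ofC _, .ofC _, .ofC _, f, g => CategoryStruct.comp (obj := C) f g
  | .ofC _, .ofC _, .ofD _, _, g => g.elim
  | .ofC _, .ofD _, _, f, _ => f.elim
  | .ofD d, .ofC c, .ofC c', f, g => (H.map (X := c) (Y := c') g).app (op d) f
  | .ofD _, .ofC _, .ofD _, _, g => g.elim
  | .ofD d, .ofD d', .ofC c, f, g => (H.obj c).map (Quiver.Hom.op (X := d) (Y := d') f) g
  | .ofD _, .ofD _, .ofD _, f, g => CategoryStruct.comp (obj := D) f g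

instance : Category.{w} (Collage H) where
  Hom := Collage.Hom H
  id
    | .ofC c => 𝟙 c
    | .ofD d => 𝟙 d
  comp := Collage.comp H
  id_comp := fun {X Y} f => match X, Y, f with
    | .ofC _, .ofC _, f => Category.id_comp (obj := C) f
    | .ofC _, .ofD _, f => f.elim
    | .ofD d, .ofC c, f => ConcreteCategory.congr_hom ((H.obj c).map_id (op d)) f
    | .ofD _, .ofD _, f => Category.id_comp (obj := D) f
  comp_id := fun {X Y} f => match X, Y, f with
    | .ofC _, .ofC _, f => Category.comp_id (obj := C) f
    | .ofC _, .ofD _, f => f.elim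
    | .ofD d, .ofC c, f => ConcreteCategory.congr_hom (NatTrans.congr_app (H.map_id c) (op d)) f
    | .ofD _, .ofD _, f => Category.comp_id (obj := D) f
  assoc := fun {X Y Z W} f g h => match X, Y, Z, W, f, g, h with
    | .ofC _, .ofC _, .ofC _, .ofC _, f, g, h => Category.assoc (obj := C) f g h
    | .ofD d, .ofC c, .ofC c', .ofC c'', f, g, h =>
      (ConcreteCategory.congr_hom (NatTrans.congr_app
        (H.map_comp (X := c) (Y := c') (Z := c'') g h) (op d)) f).symm
    | .ofD d, .ofD d', .ofC c, .ofC c', f, g, h =>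
      ConcreteCategory.congr_hom ((H.map (X := c) (Y := c') h).naturality
        (Quiver.Hom.op (X := d) (Y := d') f)) g
    | .ofD d, .ofD d', .ofD d'', .ofC c, f, g, h =>
      ConcreteCategory.congr_hom ((H.obj c).map_comp (Quiver.Hom.op (X := d') (Y := d'') g)
        (Quiver.Hom.op (X := d) (Y := d') f)) h
    | .ofD _, .ofD _, .ofD _, .ofD _, f, g, h => Category.assoc (obj := D) f g h
    | .ofC _, .ofD _, _, _, f, _, _ => f.elim
    | _, .ofC _, .ofD _, _, _, g, _ => g.elim
    | _, _, .ofC _, .ofD _, _, _, h => h.elim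

/-- The inclusion of `C` into the collage. -/
def inclC : C ⥤ Collage H where
  obj := .ofC
  map f := f

/-- The inclusion of `D` into the collage. -/
def inclD : D ⥤ Collage H where
  obj := .ofD
  map f := f

variable {E : Type v} [Category.{w} E]

/-- The slice under `inclC c` along the inclusion of `C` is the category under `c`, which has an
initial object, so the limits of this shape exist. -/
lemma hasLimit_ofC (F : C ⥤ E) (c : C) :
    (inclC H).HasPointwiseRightKanExtensionAt F (.ofC c) := by
  let X₀ : StructuredArrow (Collage.ofC c : Collage H) (inclC H) :=
    StructuredArrow.mk (Y := c) (T := inclC H) (𝟙 _)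
  have hX₀ : IsInitial X₀ := IsInitial.ofUniqueHom
    (fun Y => StructuredArrow.homMk (f := X₀) (f' := Y) (show c ⟶ Y.right from Y.hom)
      (Category.id_comp (X := Collage.ofC (H := H) c) Y.hom))
    (fun Y m => by
      ext
      exact (Category.id_comp _).symm.trans (StructuredArrow.w m))
  exact HasLimit.mk ⟨_, limitOfDiagramInitial hX₀ _⟩

/-- The slice under `inclD d` along the inclusion of `C` is the category of elements
of `H(d, -)`. -/
def structuredArrowOfD (d : D) :
    StructuredArrow (Collage.ofD d : Collage H) (inclC H) ≌ (H.flip.obj (op d)).Elements where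
  functor :=
    { obj := fun X => ⟨X.right, X.hom⟩
      map := fun f => ⟨f.right, StructuredArrow.w f⟩ }
  inverse :=
    { obj := fun x => StructuredArrow.mk (Y := x.1) (T := inclC H) x.2
      map := fun f => StructuredArrow.homMk f.1 f.2 }
  unitIso := NatIso.ofComponents (fun X => Iso.refl _)
  counitIso := NatIso.ofComponents (fun X => Iso.refl _) (fun f => by
    ext
    exact (Category.comp_id _).trans (Category.id_comp _).symm)
  functor_unitIso_comp X := by
    ext
    exact Category.id_comp _

end Collage

/-! ### Iterated gluing diagrams -/

/-- The data of an iterated gluing diagram over a strict inverse category `N`. -/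
structure IteratedGluingData (N : Type w) [SmallCategory N] [StrictInverseStructure N] where
  /-- The stages `I n`. -/
  stage : Nᵒᵖ ⥤ Cat.{w, w}
  /-- The boundaries `∂I n`. -/
  boundary : N → Cat.{w, w}
  /-- The interior `I_{<n}`, a weighted colimit of the stages with weight `N(n, -)°`. As the
  weight takes values in sets, this is the colimit of the stages over the opposite of the category
  of elements of the weight, i.e. of the category of non-identity maps `n ⟶ m`. -/
  interior (n : N) : Cocone ((CategoryOfElements.π (properHom n)).op ⋙ stage)
  isColimitInterior (n : N) : IsColimit (interior n)
  /-- The attaching map `I° n`, a functor `(∂I n)ᵒᵖ × I_{<n} → Set`. -/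
  attach (n : N) : Profunctor.{w} (interior n).pt (boundary n)
  /-- The stage `I n` is the collage of the attaching map. -/
  collageIso (n : N) : Cat.of (Collage (attach n)) ≅ stage.obj (op n)
  /-- The transition functor along a non-identity map `α : n ⟶ m` is the colimiting leg
  `I m ⥤ I_{<n}` followed by the inclusion of the interior in the collage. -/
  collageIso_comp (n : N) (x : (properHom n).Elementsᵒᵖ) :
    (interior n).ι.app x ≫ (Collage.inclC (attach n)).toCatHom ≫ (collageIso n).hom =
      stage.map (Quiver.Hom.op x.unop.2.1)

namespace IteratedGluingData

variable {N : Type w} [SmallCategory N] [StrictInverseStructure N] (𝓘 : IteratedGluingData N)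

/-- The inclusion `I_{<n} ⥤ I n`. -/
def inclInterior (n : N) : (𝓘.interior n).pt ⥤ 𝓘.stage.obj (op n) :=
  Collage.inclC (𝓘.attach n) ⋙ (𝓘.collageIso n).hom.toFunctor

/-- The inclusion `t n : ∂I n ⥤ I n`. -/
def inclBoundary (n : N) : 𝓘.boundary n ⥤ 𝓘.stage.obj (op n) :=
  Collage.inclD (𝓘.attach n) ⋙ (𝓘.collageIso n).hom.toFunctor

variable (E : Type u) [Category.{w} E]

/-- `E` has all limits indexed by the categories of elements of `I° n (i, -)`. -/
class HasMatchingLimits : Prop where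
  hasLimitsOfShape (n : N) (i : 𝓘.boundary n) :
    HasLimitsOfShape ((𝓘.attach n).flip.obj (op i)).Elements E

instance [𝓘.HasMatchingLimits E] (n : N) (F : (𝓘.interior n).pt ⥤ E) :
    (𝓘.inclInterior n).HasPointwiseRightKanExtension F := by
  intro Y
  let e := Cat.equivOfIso (𝓘.collageIso n)
  have h : ∀ X : Collage (𝓘.attach n),
      (Collage.inclC (𝓘.attach n)).HasPointwiseRightKanExtensionAt F X := by
    rintro (c | d)
    · exact Collage.hasLimit_ofC _ F c
    · have := HasMatchingLimits.hasLimitsOfShape (𝓘 := 𝓘) (E := E) n d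
      have := hasLimitsOfShape_of_equivalence (C := E)
        (Collage.structuredArrowOfD (𝓘.attach n) d).symm
      exact inferInstance
  have := h (e.inverse.obj Y)
  exact Functor.hasPointwiseRightKanExtensionAt_of_equivalence (Collage.inclC (𝓘.attach n))
    (𝓘.inclInterior n) F e (Iso.refl _) (e.inverse.obj Y) Y (e.counitIso.app Y)

/-- Restriction `E^(I n) ⥤ E^(I_{<n})`. -/
abbrev resInterior (n : N) : (𝓘.stage.obj (op n) ⥤ E) ⥤ ((𝓘.interior n).pt ⥤ E) :=
  (Functor.whiskeringLeft _ _ E).obj (𝓘.inclInterior n)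

/-- Restriction `E^(I n) ⥤ E^(∂I n)`. -/
abbrev resBoundary (n : N) : (𝓘.stage.obj (op n) ⥤ E) ⥤ (𝓘.boundary n ⥤ E) :=
  (Functor.whiskeringLeft _ _ E).obj (𝓘.inclBoundary n)

variable [𝓘.HasMatchingLimits E]

/-- The right Kan extension functor `E^(I_{<n}) ⥤ E^(I n)`. -/
noncomputable abbrev cosk (n : N) : ((𝓘.interior n).pt ⥤ E) ⥤ (𝓘.stage.obj (op n) ⥤ E) :=
  (𝓘.inclInterior n).ran

/-- The matching object functor `M n : E^(I_{<n}) ⥤ E^(∂I n)`. -/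
noncomputable abbrev matchingFunctor (n : N) : ((𝓘.interior n).pt ⥤ E) ⥤ (𝓘.boundary n ⥤ E) :=
  𝓘.cosk E n ⋙ 𝓘.resBoundary E n

/-- The matching map `m n`: the unit of the adjunction between restriction to the interior and
`cosk n`, restricted to the boundary. -/
noncomputable def matchingMap (n : N) :
    𝓘.resBoundary E n ⟶ 𝓘.resInterior E n ⋙ 𝓘.matchingFunctor E n :=
  (Functor.leftUnitor _).inv ≫
    Functor.whiskerRight ((𝓘.inclInterior n).ranAdjunction E).unit (𝓘.resBoundary E n) ≫
      (Functor.associator _ _ _).hom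

/-- For a cocone `c` under the stages, the restriction `(-)|_n : E^c ⥤ E^(I n)`. -/
abbrev resStage (c : Cocone 𝓘.stage) (n : N) : (c.pt ⥤ E) ⥤ (𝓘.stage.obj (op n) ⥤ E) :=
  (Functor.whiskeringLeft _ _ E).obj (c.ι.app (op n)).toFunctor

end IteratedGluingData

/-! ### Conjunction on a subobject classifier -/

/-- The conjunction `∧ : Ω × Ω ⟶ Ω`, the characteristic map of `(true, true) : 1 ⟶ Ω × Ω`. -/
noncomputable def conj {C : Type u} [Category.{v} C] [HasBinaryProducts C]
    (T : Subobject.Classifier C) : T.Ω ⨯ T.Ω ⟶ T.Ω :=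
  haveI : Mono (prod.lift T.truth T.truth) :=
    Subobject.Classifier.isTerminalΩ₀.mono_from (prod.lift T.truth T.truth)
  T.χ (prod.lift T.truth T.truth)

/-- The component `∧_i : Ω i × Ω i ⟶ Ω i` of the conjunction in a functor category, using that
products of functors are computed pointwise. -/
noncomputable def conjAt {J : Type w} [Category.{w} J] {E : Type u} [Category.{v} E]
    [HasFiniteLimits E] (T : Subobject.Classifier (J ⥤ E)) (i : J) :
    T.Ω.obj i ⨯ T.Ω.obj i ⟶ T.Ω.obj i :=
  (PreservesLimitPair.iso ((evaluation J E).obj i) T.Ω T.Ω).inv ≫ (conj T).app i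

namespace IteratedGluingData

variable {N : Type w} [SmallCategory N] [StrictInverseStructure N] (𝓘 : IteratedGluingData N)
  (E : Type u) [Category.{w} E] [𝓘.HasMatchingLimits E]

/-- The map `M n (true) : M n 1 ⟶ M n Ω` for a subobject classifier of `E^c`, where `c` is a cocone
under the stages. -/
noncomputable abbrev matchingTruth (c : Cocone 𝓘.stage) (T : Subobject.Classifier (c.pt ⥤ E))
    (n : N) :
    (𝓘.matchingFunctor E n).obj ((𝓘.resInterior E n).obj ((𝓘.resStage E c n).obj T.Ω₀)) ⟶
      (𝓘.matchingFunctor E n).obj ((𝓘.resInterior E n).obj ((𝓘.resStage E c n).obj T.Ω)) :=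
  (𝓘.matchingFunctor E n).map ((𝓘.resInterior E n).map ((𝓘.resStage E c n).map T.truth))

instance (c : Cocone 𝓘.stage) (T : Subobject.Classifier (c.pt ⥤ E)) (n : N) :
    Mono (𝓘.matchingTruth E c T n) := by
  have : IsSplitMono T.truth := Subobject.Classifier.isTerminalΩ₀.isSplitMono_from _
  infer_instance

end IteratedGluingData

/-! ### Functors out of colimits in `Cat` -/

/-! A subobject of `X` on a stage `I n` is a subobject `V` on the interior together with a subobject
`U` on the boundary such that the matching map of `X` sends `U` into `M n V`. If `a` classifies `V`,
this containment says `χ_U = χ_U ∧ (χ_{M n true} ∘ M n a ∘ m n)`. So the value of the classifier at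
a boundary object should consist of pairs (truth value, matching datum) whose first entry lies below
the truth of the second, and this is the equaliser of the theorem. `IsGlued` records this shape, and
`IsGlued.isPointwiseClassifier` shows that gluing extends a classifier from the interior to the
stage.

To build `Ω` and its point together, functors take values in `Under (⊤_ E)`. `exists_isGlued`
extends any such functor from the interior to a glued one on the stage, restricting to the original
on the nose. Strictness is what allows well-founded recursion on degree to produce a strictly
compatible family, hence a functor on the colimit (`exists_functor_of_extend`). The classifier
property then follows by induction on degree: the interior is a colimit of stages of lower degree,
and the property passes to colimits in `Cat` (`IsPointwiseClassifier.of_isColimit`) because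
uniqueness of characteristic maps makes the stagewise ones compatible.

The universal property of these colimits concerns small categories only, whereas `E` is merely
locally small. Functors to a large category are therefore factored through the category induced on
their image. -/

namespace CategoryTheory.InducedCategory

variable {A : Type*} [Category A] {S : Type*} {D : Type*} [Category D] {F : S → D}

/-- The lift of a functor to an induced category, given a lift on objects. -/
@[simps]
def liftFunctor (G : A ⥤ D) (obj : A → S) (h : ∀ a, F (obj a) = G.obj a) :
    A ⥤ InducedCategory D F where
  obj := obj
  map f := homMk (eqToHom (h _) ≫ G.map f ≫ eqToHom (h _).symm)

lemma liftFunctor_comp (G : A ⥤ D) (obj : A → S) (h : ∀ a, F (obj a) = G.obj a) :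
    liftFunctor G obj h ⋙ inducedFunctor F = G :=
  Functor.ext h (fun _ _ _ => rfl)

/-- Functors into an induced category are determined by their composites with the inclusion if the
inclusion is injective on objects. -/
lemma functor_ext (hF : Function.Injective F) {L L' : A ⥤ InducedCategory D F}
    (h : L ⋙ inducedFunctor F = L' ⋙ inducedFunctor F) : L = L' :=
  Functor.ext (fun a => hF (Functor.congr_obj h a)) (fun a b f => (inducedFunctor F).map_injective
    (by simpa [eqToHom_map] using Functor.congr_hom h f))

end CategoryTheory.InducedCategory

namespace CatColimit

variable {J : Type w} [SmallCategory J] {F : J ⥤ Cat.{w, w}} {c : Cocone F}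
  {D : Type u} [Category.{w} D]

lemma cocone_w (c : Cocone F) {i j : J} (f : i ⟶ j) :
    (F.map f).toFunctor ⋙ (c.ι.app j).toFunctor = (c.ι.app i).toFunctor :=
  congrArg Cat.Hom.toFunctor (c.w f)

/-- The colimit in `Cat` of small categories is also a colimit among locally small categories:
existence. -/
theorem exists_desc (G : ∀ j, F.obj j ⥤ D)
    (hG : ∀ {i j : J} (f : i ⟶ j), (F.map f).toFunctor ⋙ G j = G i) (hc : IsColimit c) :
    ∃ K : c.pt ⥤ D, ∀ j, (c.ι.app j).toFunctor ⋙ K = G j := by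
  -- The quotient by the kernel of `φ` is a small copy of the set of objects hit by the family. As
  -- `val` is injective on it, strict equality of functors can be tested in `D`.
  let φ : (Σ j, F.obj j) → D := fun p => (G p.1).obj p.2
  let val : Quotient (Setoid.ker φ) → D := Quotient.lift φ (fun _ _ h => h)
  have hval : Function.Injective val := Setoid.kerLift_injective φ
  let L (j : J) : F.obj j ⥤ InducedCategory D val :=
    InducedCategory.liftFunctor (G j) (fun y => Quotient.mk _ ⟨j, y⟩) (fun _ => rfl)
  have hL (j : J) : L j ⋙ inducedFunctor val = G j := InducedCategory.liftFunctor_comp _ _ _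
  let s : Cocone F :=
    { pt := Cat.of (InducedCategory D val)
      ι :=
        { app := fun j => (L j).toCatHom
          naturality := fun i j f => by
            ext1
            refine InducedCategory.functor_ext hval ?_
            change (F.map f).toFunctor ⋙ (L j ⋙ inducedFunctor val) = L i ⋙ inducedFunctor val
            rw [hL, hL, hG] } }
  refine ⟨(hc.desc s).toFunctor ⋙ inducedFunctor val, fun j => ?_⟩
  have h : (c.ι.app j).toFunctor ⋙ (hc.desc s).toFunctor = L j :=
    congrArg Cat.Hom.toFunctor (hc.fac s j)
  exact (congrArg (· ⋙ inducedFunctor val) h).trans (hL j)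

/-- The colimit in `Cat` of small categories is also a colimit among locally small categories:
uniqueness. -/
theorem functor_ext (hc : IsColimit c) {K K' : c.pt ⥤ D}
    (h : ∀ j, (c.ι.app j).toFunctor ⋙ K = (c.ι.app j).toFunctor ⋙ K') : K = K' := by
  let φ : c.pt ⊕ c.pt → D := Sum.elim K.obj K'.obj
  let val : Quotient (Setoid.ker φ) → D := Quotient.lift φ (fun _ _ h => h)
  have hval : Function.Injective val := Setoid.kerLift_injective φ
  let L : c.pt ⥤ InducedCategory D val :=
    InducedCategory.liftFunctor K (fun y => Quotient.mk _ (Sum.inl y)) (fun _ => rfl)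
  let L' : c.pt ⥤ InducedCategory D val :=
    InducedCategory.liftFunctor K' (fun y => Quotient.mk _ (Sum.inr y)) (fun _ => rfl)
  have hL : L ⋙ inducedFunctor val = K := InducedCategory.liftFunctor_comp _ _ _
  have hL' : L' ⋙ inducedFunctor val = K' := InducedCategory.liftFunctor_comp _ _ _
  have : L.toCatHom = L'.toCatHom := hc.hom_ext (fun j => by
    ext1
    refine InducedCategory.functor_ext hval ?_
    change (c.ι.app j).toFunctor ⋙ (L ⋙ inducedFunctor val) =
      (c.ι.app j).toFunctor ⋙ (L' ⋙ inducedFunctor val)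
    rw [hL, hL', h])
  rw [← hL, ← hL', show L = L' from congrArg Cat.Hom.toFunctor this]

/-- The legs of a colimit in `Cat` are jointly surjective on objects. -/
theorem exists_obj_eq (hc : IsColimit c) (x : c.pt) :
    ∃ (j : J) (y : F.obj j), (c.ι.app j).toFunctor.obj y = x := by
  -- The induced category is indiscrete on `Prop`, so a functor into it is an arbitrary predicate on
  -- objects. Being in the image of a leg and being true agree on every leg, hence everywhere.
  let val : Prop → Discrete PUnit.{w + 1} := fun _ => ⟨PUnit.unit⟩
  let K (S : c.pt → Prop) : c.pt ⥤ InducedCategory (Discrete PUnit.{w + 1}) val :=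
    InducedCategory.liftFunctor ((Functor.const _).obj ⟨PUnit.unit⟩) S (fun _ => rfl)
  let S : c.pt → Prop := fun x => ∃ (j : J) (y : F.obj j), (c.ι.app j).toFunctor.obj y = x
  have hS (j : J) (y : F.obj j) : S ((c.ι.app j).toFunctor.obj y) = True :=
    eq_true ⟨j, y, rfl⟩
  have h : K S = K (fun _ => True) := functor_ext hc (fun j =>
    CategoryTheory.Functor.ext (hS j) (fun _ _ _ => InducedCategory.hom_ext (Subsingleton.elim _ _)))
  exact of_eq_true (Functor.congr_obj h x)

theorem natTrans_ext (hc : IsColimit c) {X Y : c.pt ⥤ D} {τ τ' : X ⟶ Y}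
    (h : ∀ j (y : F.obj j), τ.app ((c.ι.app j).toFunctor.obj y) =
      τ'.app ((c.ι.app j).toFunctor.obj y)) : τ = τ' := by
  ext x
  obtain ⟨j, y, rfl⟩ := exists_obj_eq hc x
  exact h j y

/-- A natural transformation as a functor to the arrow category. -/
@[simps]
def toArrow {A : Type*} [Category A] {X Y : A ⥤ D} (τ : X ⟶ Y) : A ⥤ Arrow D where
  obj a := Arrow.mk (τ.app a)
  map f := Arrow.homMk (X.map f) (Y.map f)

/-- The functors `L` and `L'` are equal only propositionally, so the components of `τ` and `τ'` have
different types; comparing them as objects of the arrow category avoids transports. -/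
lemma toArrow_congr {A B : Type*} [Category A] [Category B] {X Y : B ⥤ D} {L L' : A ⥤ B}
    (h : L = L') {τ : L ⋙ X ⟶ L ⋙ Y} {τ' : L' ⋙ X ⟶ L' ⋙ Y}
    (hτ : ∀ a, Arrow.mk (τ.app a) = Arrow.mk (τ'.app a)) : toArrow τ = toArrow τ' := by
  subst h
  congr 1
  ext a
  exact Arrow.mk_injective _ _ (hτ a)

/-- A compatible family of natural transformations between the restrictions of two functors to
the stages of a colimit in `Cat` is induced by a natural transformation. -/
theorem exists_natTrans (hc : IsColimit c) (X Y : c.pt ⥤ D)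
    (τ : ∀ j, (c.ι.app j).toFunctor ⋙ X ⟶ (c.ι.app j).toFunctor ⋙ Y)
    (hτ : ∀ {i j : J} (f : i ⟶ j) (y : F.obj i),
      Arrow.mk ((τ j).app ((F.map f).toFunctor.obj y)) = Arrow.mk ((τ i).app y)) :
    ∃ σ : X ⟶ Y, ∀ j, Functor.whiskerLeft (c.ι.app j).toFunctor σ = τ j := by
  -- The family becomes a strictly compatible family of functors to the arrow category and descends
  -- to `Φ`. By uniqueness of descent, source and target of `Φ` are `X` and `Y`.
  obtain ⟨Φ, hΦ⟩ := exists_desc (fun j => toArrow (τ j)) (fun {i j} f =>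
    toArrow_congr (L := (F.map f).toFunctor ⋙ (c.ι.app j).toFunctor) (cocone_w c f)
      (τ := Functor.whiskerLeft (F.map f).toFunctor (τ j)) (hτ f)) hc
  have hX : X = Φ ⋙ Arrow.leftFunc := functor_ext hc (fun j => by
    rw [← Functor.assoc, hΦ]; rfl)
  have hY : Y = Φ ⋙ Arrow.rightFunc := functor_ext hc (fun j => by
    rw [← Functor.assoc, hΦ]; rfl)
  subst hX hY
  refine ⟨Functor.whiskerLeft Φ Arrow.leftToRight, fun j => ?_⟩
  ext y
  exact Arrow.mk_injective _ _ (Functor.congr_obj (hΦ j) y)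

end CatColimit

/-! ### Families of functors on the stages -/

namespace IteratedGluingData

variable {N : Type w} [SmallCategory N] [StrictInverseStructure N] (𝓘 : IteratedGluingData N)

lemma deg_lt_of_not_isIdentity {i j : N} (f : i ⟶ j) (hf : ¬ IsIdentity f) :
    GeneralisedInverseStructure.deg j < GeneralisedInverseStructure.deg i :=
  GeneralisedInverseStructure.deg_lt f
    (fun h => hf (StrictInverseStructure.isIdentity_of_isIso f h))

/-- The leg `I m ⥤ I_{<n}` of the interior at a non-identity map `n ⟶ m`. -/
abbrev interiorLeg (n : N) (x : (properHom n).Elementsᵒᵖ) :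
    𝓘.stage.obj (op x.unop.1) ⥤ (𝓘.interior n).pt :=
  ((𝓘.interior n).ι.app x).toFunctor

lemma interiorLeg_comp_inclInterior (n : N) (x : (properHom n).Elementsᵒᵖ) :
    𝓘.interiorLeg n x ⋙ 𝓘.inclInterior n = (𝓘.stage.map x.unop.2.1.op).toFunctor :=
  congrArg Cat.Hom.toFunctor (𝓘.collageIso_comp n x)

variable {D : Type u} [Category.{w} D]

/-- Functors on the colimit of the stages can be constructed by successively extending functors
from the interiors to the stages. -/
theorem exists_functor_of_extend [Nonempty D] {c : Cocone 𝓘.stage} (hc : IsColimit c)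
    (extend : ∀ n, ((𝓘.interior n).pt ⥤ D) → (𝓘.stage.obj (op n) ⥤ D))
    (hextend : ∀ n G, 𝓘.inclInterior n ⋙ extend n G = G) :
    ∃ P : c.pt ⥤ D, ∀ n, ∃ G, (c.ι.app (op n)).toFunctor ⋙ P = extend n G := by
  classical
  -- Whether the earlier stages are compatible is not known while the recursion is being defined, so
  -- a constant functor serves as default value; `hdesc` shows that it is never used.
  let step (n : N) (rec : ∀ m : N, GeneralisedInverseStructure.deg m <
      GeneralisedInverseStructure.deg n → (𝓘.stage.obj (op m) ⥤ D)) : 𝓘.stage.obj (op n) ⥤ D :=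
    extend n (if h : ∃ G, ∀ x, 𝓘.interiorLeg n x ⋙ G =
        rec x.unop.1 (deg_lt_of_not_isIdentity x.unop.2.1 x.unop.2.2)
      then h.choose else (Functor.const _).obj (Classical.arbitrary D))
  have wf : WellFounded (fun m n : N => GeneralisedInverseStructure.deg m <
      GeneralisedInverseStructure.deg n) := (measure GeneralisedInverseStructure.deg).wf
  let Q : ∀ n : N, 𝓘.stage.obj (op n) ⥤ D := wf.fix step
  have hQ (n : N) : Q n = step n (fun m _ => Q m) := wf.fix_eq step n
  have hdesc (n : N) : ∃ G, (∀ x, 𝓘.interiorLeg n x ⋙ G = Q x.unop.1) ∧ Q n = extend n G := by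
    induction n using wf.induction with
    | _ n ih =>
    -- For a non-identity `g`, the functor `Q m` extends some `G` whose legs are the earlier values,
    -- and `g` factors through the interior of `m`. Since extension is strict, restricting along `g`
    -- gives `Q m'` exactly.
    have hcompat : ∀ {m m' : N} (g : m ⟶ m'),
        GeneralisedInverseStructure.deg m < GeneralisedInverseStructure.deg n →
        (𝓘.stage.map g.op).toFunctor ⋙ Q m = Q m' := by
      intro m m' g hm
      by_cases hg : IsIdentity g
      · cases hg
        rw [op_id, 𝓘.stage.map_id]
        rfl
      · obtain ⟨G, hG, hG'⟩ := ih m hm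
        let x : (properHom m).Elementsᵒᵖ := op ⟨m', ⟨g, hg⟩⟩
        rw [← 𝓘.interiorLeg_comp_inclInterior m x, hG', Functor.assoc, hextend, hG]
    have h : ∃ G, ∀ x, 𝓘.interiorLeg n x ⋙ G = Q x.unop.1 :=
      CatColimit.exists_desc (fun x => Q x.unop.1)
        (fun {x x'} f => by
          exact hcompat f.unop.1 (deg_lt_of_not_isIdentity x'.unop.2.1 x'.unop.2.2))
        (𝓘.isColimitInterior n)
    refine ⟨h.choose, h.choose_spec, ?_⟩
    rw [hQ]
    exact congrArg (extend n) (dif_pos h)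
  obtain ⟨P, hP⟩ := CatColimit.exists_desc (fun n => Q n.unop) (fun {m n} f => by
    obtain ⟨f, rfl⟩ : ∃ g, f = Quiver.Hom.op g := ⟨f.unop, rfl⟩
    by_cases hf : IsIdentity f
    · induction n using Opposite.rec with | _ n
      induction m using Opposite.rec with | _ m
      cases hf
      rw [op_id, 𝓘.stage.map_id]
      rfl
    · obtain ⟨G, hG, hG'⟩ := hdesc n.unop
      let x : (properHom n.unop).Elementsᵒᵖ := op ⟨m.unop, ⟨f, hf⟩⟩
      refine Eq.trans ?_ (hG x)
      rw [hG', ← hextend n.unop G, ← Functor.assoc]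
      rw [𝓘.interiorLeg_comp_inclInterior, hextend]) hc
  exact ⟨P, fun n => ⟨(hdesc n).choose, (hP (op n)).trans (hdesc n).choose_spec.2⟩⟩

end IteratedGluingData

/-! ### Pointed functors and pointwise classifiers -/

section Pointed

variable {K : Type*} [Category K] {E : Type u} [Category.{v} E] [HasTerminal E]

/-- The functor underlying a functor to the category of pointed objects of `E`. -/
noncomputable abbrev unpoint (P : K ⥤ Under (⊤_ E)) : K ⥤ E := P ⋙ Under.forget _

/-- The global element given by a functor to the category of pointed objects of `E`. -/
@[simps]
noncomputable def point (P : K ⥤ Under (⊤_ E)) : (Functor.const K).obj (⊤_ E) ⟶ unpoint P where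
  app k := (P.obj k).hom
  naturality _ _ f := (Category.id_comp _).trans (Under.w (P.map f)).symm

/-- A pointed functor is a pointwise classifier if every monomorphism has a unique characteristic
map, where pullbacks are meant pointwise. -/
def IsPointwiseClassifier (P : K ⥤ Under (⊤_ E)) : Prop :=
  ∀ ⦃U X : K ⥤ E⦄ (m : U ⟶ X), (∀ k, Mono (m.app k)) →
    ∃! χ : X ⟶ unpoint P,
      ∀ k, IsPullback (m.app k) (terminal.from _) (χ.app k) ((point P).app k)

/-- Once `L` and `L'` are identified, both transformations are characteristic maps of the same
monomorphism. This supplies the compatibility required by `CatColimit.exists_natTrans`. -/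
lemma IsPointwiseClassifier.arrow_mk_eq {A : Type*} [Category A] {P : K ⥤ Under (⊤_ E)}
    {U X : K ⥤ E} (m : U ⟶ X) (hm : ∀ k, Mono (m.app k)) {L L' : A ⥤ K} (hL : L = L')
    (hP : IsPointwiseClassifier (L' ⋙ P))
    {τ : L ⋙ X ⟶ L ⋙ unpoint P} {τ' : L' ⋙ X ⟶ L' ⋙ unpoint P}
    (hτ : ∀ a, IsPullback (m.app (L.obj a)) (terminal.from _) (τ.app a)
      ((point P).app (L.obj a)))
    (hτ' : ∀ a, IsPullback (m.app (L'.obj a)) (terminal.from _) (τ'.app a)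
      ((point P).app (L'.obj a))) (a : A) :
    Arrow.mk (τ.app a) = Arrow.mk (τ'.app a) := by
  subst hL
  rw [(hP (Functor.whiskerLeft L m) (fun a => hm (L.obj a))).unique hτ hτ']

/-- Being a pointwise classifier on a colimit of categories can be checked on the stages. -/
theorem IsPointwiseClassifier.of_isColimit {E : Type u} [Category.{w} E] [HasTerminal E]
    {J : Type w} [SmallCategory J] {F : J ⥤ Cat.{w, w}}
    {c : Cocone F} (hc : IsColimit c) {P : c.pt ⥤ Under (⊤_ E)}
    (hP : ∀ j, IsPointwiseClassifier ((c.ι.app j).toFunctor ⋙ P)) :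
    IsPointwiseClassifier P := by
  intro U X m hm
  choose χ hχ huniq using fun j => hP j (Functor.whiskerLeft (c.ι.app j).toFunctor m)
    (fun y => hm ((c.ι.app j).toFunctor.obj y))
  obtain ⟨σ, hσ⟩ := CatColimit.exists_natTrans hc X (unpoint P) χ (fun {i j} f y =>
    IsPointwiseClassifier.arrow_mk_eq m hm
      (L := (F.map f).toFunctor ⋙ (c.ι.app j).toFunctor) (CatColimit.cocone_w c f)
      (hP i) (τ := Functor.whiskerLeft (F.map f).toFunctor (χ j))
      (fun a => hχ j ((F.map f).toFunctor.obj a)) (hχ i) y)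
  refine ⟨σ, fun k => ?_, fun σ' hσ' => CatColimit.natTrans_ext hc (fun j y => ?_)⟩
  · obtain ⟨j, y, rfl⟩ := CatColimit.exists_obj_eq hc k
    have := hχ j y
    rwa [← hσ] at this
  · exact NatTrans.congr_app ((huniq j (Functor.whiskerLeft _ σ')
      (fun y => hσ' ((c.ι.app j).toFunctor.obj y))).trans (hσ j).symm) y

end Pointed

/-- A pointwise classifier is a subobject classifier. -/
noncomputable def IsPointwiseClassifier.classifier {K : Type*} [Category K] {E : Type u}
    [Category.{v} E] [HasFiniteLimits E] {P : K ⥤ Under (⊤_ E)} (hP : IsPointwiseClassifier P) :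
    Subobject.Classifier (K ⥤ E) :=
  have h {U X : K ⥤ E} (m : U ⟶ X) [Mono m] := hP m (fun _ => inferInstance)
  .mkOfTerminalΩ₀ ((Functor.const K).obj (⊤_ E))
    (IsTerminal.ofUniqueHom (fun _ => { app := fun _ => terminal.from _ })
      (fun _ _ => by ext; exact terminal.hom_ext _ _))
    (unpoint P) (point P) (fun m _ => (h m).choose)
    (fun m _ => .of_forall_isPullback_app (h m).choose_spec.1)
    (fun m _ χ' hχ' => (h m).choose_spec.2 χ' (fun k => hχ'.app k))

/-! ### Conjunction -/

/-- As `m` and `t` are monomorphisms, uniqueness of the lift and its compatibility with `s` are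
automatic. -/
lemma isPullback_of_exists_lift {C : Type u} [Category.{v} C] {U X T Y : C} {m : U ⟶ X} [Mono m]
    {s : U ⟶ T} {χ : X ⟶ Y} {t : T ⟶ Y} [Mono t] (w : m ≫ χ = s ≫ t)
    (h : ∀ (Z : C) (z : Z ⟶ X) (r : Z ⟶ T), z ≫ χ = r ≫ t → ∃ l : Z ⟶ U, l ≫ m = z) :
    IsPullback m s χ t where
  w := w
  isLimit' := ⟨PullbackCone.IsLimit.mk _ (fun c => (h _ c.fst c.snd c.condition).choose)
    (fun c => (h _ c.fst c.snd c.condition).choose_spec)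
    (fun c => by
      rw [← cancel_mono t, Category.assoc, ← w, ← c.condition,
        reassoc_of% (h _ c.fst c.snd c.condition).choose_spec])
    (fun c l hl _ => by
      rw [← cancel_mono m, hl, (h _ c.fst c.snd c.condition).choose_spec])⟩

section Conj

variable {C : Type u} [Category.{v} C] [HasBinaryProducts C] (T : Subobject.Classifier C)

instance : Mono (prod.lift T.truth T.truth) :=
  Subobject.Classifier.isTerminalΩ₀.mono_from (prod.lift T.truth T.truth)

lemma conj_isPullback :
    IsPullback (prod.lift T.truth T.truth) (T.χ₀ _) (conj T) T.truth :=
  T.isPullback (prod.lift T.truth T.truth)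

lemma truth_conj_truth : prod.lift T.truth T.truth ≫ conj T = T.truth := by
  rw [(conj_isPullback T).w, Subsingleton.elim (T.χ₀ T.Ω₀) (𝟙 _), Category.id_comp]

/-- A subobject contained in another one is its own intersection with it. -/
lemma χ_conj_eq_χ {U X : C} (m : U ⟶ X) [Mono m] (g : X ⟶ T.Ω) (h : m ≫ g = T.χ₀ U ≫ T.truth) :
    prod.lift (T.χ m) g ≫ conj T = T.χ m := by
  refine T.uniq m (χ₀' := T.χ₀ U) (isPullback_of_exists_lift ?_ (fun Z z r hz => ?_))
  · rw [← Category.assoc, prod.comp_lift, h, (T.isPullback m).w, ← prod.comp_lift, Category.assoc,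
      truth_conj_truth]
  · rw [← Category.assoc] at hz
    have h1 := (conj_isPullback T).lift_fst _ _ hz
    have h2 := congrArg (· ≫ prod.fst) h1
    simp only [Category.assoc, prod.lift_fst] at h2
    exact ⟨(T.isPullback m).lift z _ h2.symm, (T.isPullback m).lift_fst _ _ _⟩

end Conj

section ConjAt

variable {J : Type w} [Category.{w} J] {E : Type u} [Category.{v} E] [HasFiniteLimits E]
  (T : Subobject.Classifier (J ⥤ E)) (i : J)

/-- The values of the domain of the truth map are terminal. -/
noncomputable def isTerminalΩ₀Obj : IsTerminal (T.Ω₀.obj i) :=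
  IsTerminal.isTerminalObj ((evaluation J E).obj i) _ Subobject.Classifier.isTerminalΩ₀

/-- Pointwise products of functors. -/
lemma prod_lift_comp_inv_fst {F G : J ⥤ E} {Z : E} (f : Z ⟶ F.obj i) (g : Z ⟶ G.obj i) :
    (prod.lift f g ≫ (PreservesLimitPair.iso ((evaluation J E).obj i) F G).inv) ≫
      (prod.fst : F ⨯ G ⟶ F).app i = f := by
  have := PreservesLimitPair.iso_inv_fst ((evaluation J E).obj i) F G
  dsimp only [evaluation_obj_map] at this
  rw [Category.assoc, this]
  exact prod.lift_fst _ _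

lemma prod_lift_comp_inv_snd {F G : J ⥤ E} {Z : E} (f : Z ⟶ F.obj i) (g : Z ⟶ G.obj i) :
    (prod.lift f g ≫ (PreservesLimitPair.iso ((evaluation J E).obj i) F G).inv) ≫
      (prod.snd : F ⨯ G ⟶ G).app i = g := by
  have := PreservesLimitPair.iso_inv_snd ((evaluation J E).obj i) F G
  dsimp only [evaluation_obj_map] at this
  rw [Category.assoc, this]
  exact prod.lift_snd _ _

lemma prod_obj_hom_ext {F G : J ⥤ E} {Z : E} {f g : Z ⟶ (F ⨯ G).obj i}
    (h₁ : f ≫ (prod.fst : F ⨯ G ⟶ F).app i = g ≫ (prod.fst : F ⨯ G ⟶ F).app i)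
    (h₂ : f ≫ (prod.snd : F ⨯ G ⟶ G).app i = g ≫ (prod.snd : F ⨯ G ⟶ G).app i) : f = g := by
  rw [← cancel_mono (PreservesLimitPair.iso ((evaluation J E).obj i) F G).hom]
  apply prod.hom_ext
  · have := prodComparison_fst (A := F) (B := G) ((evaluation J E).obj i)
    simp only [Category.assoc, PreservesLimitPair.iso_hom]
    exact (congrArg (f ≫ ·) this).trans (h₁.trans (congrArg (g ≫ ·) this).symm)
  · have := prodComparison_snd (A := F) (B := G) ((evaluation J E).obj i)
    simp only [Category.assoc, PreservesLimitPair.iso_hom]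
    exact (congrArg (f ≫ ·) this).trans (h₂.trans (congrArg (g ≫ ·) this).symm)

lemma prod_lift_app_conjAt {X : J ⥤ E} (f g : X ⟶ T.Ω) :
    prod.lift (f.app i) (g.app i) ≫ conjAt T i = (prod.lift f g ≫ conj T).app i := by
  rw [conjAt, ← Category.assoc, NatTrans.comp_app]
  congr 1
  apply prod_obj_hom_ext
  · rw [prod_lift_comp_inv_fst, ← NatTrans.comp_app, prod.lift_fst]
  · rw [prod_lift_comp_inv_snd, ← NatTrans.comp_app, prod.lift_snd]

/-- If a conjunction holds, then so do the conjuncts. -/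
lemma eq_truth_of_conjAt {Z : E} (f g : Z ⟶ T.Ω.obj i) (s : Z ⟶ T.Ω₀.obj i)
    (h : prod.lift f g ≫ conjAt T i = s ≫ T.truth.app i) :
    f = s ≫ T.truth.app i ∧ g = s ≫ T.truth.app i := by
  rw [conjAt, ← Category.assoc] at h
  have hp := (conj_isPullback T).app i
  have h1 := hp.lift_fst _ _ h
  rw [(isTerminalΩ₀Obj T i).hom_ext (hp.lift _ _ h) s] at h1
  constructor
  · rw [← prod_lift_comp_inv_fst i f g, ← h1, Category.assoc, ← NatTrans.comp_app, prod.lift_fst]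
  · rw [← prod_lift_comp_inv_snd i f g, ← h1, Category.assoc, ← NatTrans.comp_app, prod.lift_snd]

end ConjAt

/-! ### Matching objects -/

namespace IteratedGluingData

variable {N : Type w} [SmallCategory N] [StrictInverseStructure N] (𝓘 : IteratedGluingData N)
  {E : Type u} [Category.{w} E] [𝓘.HasMatchingLimits E] {n : N}

/-- The projections of the limit that computes a matching object. -/
noncomputable def matchingProj (F : (𝓘.interior n).pt ⥤ E) {d : 𝓘.boundary n}
    {c : (𝓘.interior n).pt} (h : (𝓘.inclBoundary n).obj d ⟶ (𝓘.inclInterior n).obj c) :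
    ((𝓘.matchingFunctor E n).obj F).obj d ⟶ F.obj c :=
  (((𝓘.inclInterior n).ran).obj F).map h ≫ ((𝓘.inclInterior n).ranCounit.app F).app c

lemma matchingProj_hom_ext {F : (𝓘.interior n).pt ⥤ E} {d : 𝓘.boundary n} {Z : E}
    {f g : Z ⟶ ((𝓘.matchingFunctor E n).obj F).obj d}
    (h : ∀ (c : (𝓘.interior n).pt)
      (h : (𝓘.inclBoundary n).obj d ⟶ (𝓘.inclInterior n).obj c),
      f ≫ 𝓘.matchingProj F h = g ≫ 𝓘.matchingProj F h) : f = g :=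
  ((𝓘.inclInterior n).isPointwiseRightKanExtensionRanCounit F
    ((𝓘.inclBoundary n).obj d)).hom_ext (fun x => h x.right x.hom)

lemma map_matchingProj {F G : (𝓘.interior n).pt ⥤ E} (φ : F ⟶ G) {d : 𝓘.boundary n}
    {c : (𝓘.interior n).pt} (h : (𝓘.inclBoundary n).obj d ⟶ (𝓘.inclInterior n).obj c) :
    ((𝓘.matchingFunctor E n).map φ).app d ≫ 𝓘.matchingProj G h =
      𝓘.matchingProj F h ≫ φ.app c := by
  have h1 := (((𝓘.inclInterior n).ran (H := E)).map φ).naturality h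
  have h2 := NatTrans.congr_app (((𝓘.inclInterior n).ranCounit (H := E)).naturality φ) c
  exact ((Category.assoc _ _ _).symm.trans (congrArg (· ≫ _) h1.symm)).trans
    ((Category.assoc _ _ _).trans ((congrArg (_ ≫ ·) h2).trans (Category.assoc _ _ _).symm))

lemma obj_map_matchingProj (F : (𝓘.interior n).pt ⥤ E) {d d' : 𝓘.boundary n} (k : d ⟶ d')
    {c : (𝓘.interior n).pt} (h : (𝓘.inclBoundary n).obj d' ⟶ (𝓘.inclInterior n).obj c) :
    ((𝓘.matchingFunctor E n).obj F).map k ≫ 𝓘.matchingProj F h =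
      𝓘.matchingProj F ((𝓘.inclBoundary n).map k ≫ h) := by
  simp [matchingProj]

lemma matchingProj_map (F : (𝓘.interior n).pt ⥤ E) {d : 𝓘.boundary n}
    {c c' : (𝓘.interior n).pt} (h : (𝓘.inclBoundary n).obj d ⟶ (𝓘.inclInterior n).obj c)
    (k : c ⟶ c') :
    𝓘.matchingProj F h ≫ F.map k = 𝓘.matchingProj F (h ≫ (𝓘.inclInterior n).map k) := by
  have h2 := ((𝓘.inclInterior n).ranCounit.app F).naturality k
  simp only [matchingProj, Functor.map_comp, Category.assoc]
  exact congrArg (_ ≫ ·) h2.symm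

/-- By naturality of the unit this reduces to a triangle identity. It shows that the matching map
encodes the action of `X` on the maps from the boundary to the interior. -/
lemma matchingMap_matchingProj (X : 𝓘.stage.obj (op n) ⥤ E) {d : 𝓘.boundary n}
    {c : (𝓘.interior n).pt} (h : (𝓘.inclBoundary n).obj d ⟶ (𝓘.inclInterior n).obj c) :
    ((𝓘.matchingMap E n).app X).app d ≫ 𝓘.matchingProj _ h = X.map h := by
  have h1 : ((𝓘.matchingMap E n).app X).app d =
      (((𝓘.inclInterior n).ranAdjunction E).unit.app X).app ((𝓘.inclBoundary n).obj d) := by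
    simp [matchingMap]
  have h2 := (((𝓘.inclInterior n).ranAdjunction E).unit.app X).naturality h
  have h3 := (𝓘.inclInterior n).ranCounit_app_app_ranAdjunction_unit_app_app X c
  rw [h1]
  exact ((Category.assoc _ _ _).symm.trans (congrArg (· ≫ _) h2.symm)).trans
    ((Category.assoc _ _ _).trans ((congrArg (_ ≫ ·) h3).trans (Category.comp_id _)))

end IteratedGluingData

/-! ### Gluing classifiers -/

/-- The universal property of the equaliser of `fst` and `c ∘ (id × k)`, in terms of components. -/
lemma exists_isLimit_fork_iff {E : Type u} [Category.{v} E] [HasFiniteLimits E] {W A B : E}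
    (p : W ⟶ A) (m : W ⟶ B) (k : B ⟶ A) (c : A ⨯ A ⟶ A) :
    (∃ h : prod.lift p m ≫ prod.fst = prod.lift p m ≫ prod.map (𝟙 A) k ≫ c,
      Nonempty (IsLimit (Fork.ofι (prod.lift p m) h))) ↔
    (p = prod.lift p (m ≫ k) ≫ c ∧
      (∀ (Z : E) (f g : Z ⟶ W), f ≫ p = g ≫ p → f ≫ m = g ≫ m → f = g) ∧
      ∀ (Z : E) (a : Z ⟶ A) (b : Z ⟶ B), a = prod.lift a (b ≫ k) ≫ c →
        ∃ l : Z ⟶ W, l ≫ p = a ∧ l ≫ m = b) := by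
  have key {Z : E} (a : Z ⟶ A) (b : Z ⟶ B) : prod.lift a b ≫ prod.fst =
      prod.lift a b ≫ prod.map (𝟙 A) k ≫ c ↔ a = prod.lift a (b ≫ k) ≫ c := by
    rw [prod.lift_fst, prod.lift_map_assoc, Category.comp_id]
  constructor
  · rintro ⟨h, ⟨hl⟩⟩
    refine ⟨(key p m).1 h, fun Z f g h₁ h₂ => Fork.IsLimit.hom_ext hl ?_, fun Z a b hab => ?_⟩
    · rw [Fork.ι_ofι, prod.comp_lift, prod.comp_lift, h₁, h₂]
    · have h1 := Fork.IsLimit.lift_ι' hl (prod.lift a b) ((key a b).2 hab)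
      refine ⟨Fork.IsLimit.lift hl (prod.lift a b) ((key a b).2 hab), ?_, ?_⟩
      · simpa only [Category.assoc, Fork.ι_ofι, prod.lift_fst] using congrArg (· ≫ prod.fst) h1
      · simpa only [Category.assoc, Fork.ι_ofι, prod.lift_snd] using congrArg (· ≫ prod.snd) h1
  · rintro ⟨h₁, h₂, h₃⟩
    have hs (s : Fork (prod.fst : A ⨯ B ⟶ A) (prod.map (𝟙 A) k ≫ c)) :
        ∃ l : s.pt ⟶ W, l ≫ prod.lift p m = s.ι := by
      obtain ⟨l, hl₁, hl₂⟩ := h₃ s.pt (s.ι ≫ prod.fst) (s.ι ≫ prod.snd) ((key _ _).1 (by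
        rw [← prod.comp_lift, prod.lift_fst_snd, Category.comp_id, s.condition]))
      exact ⟨l, by
        rw [prod.comp_lift, hl₁, hl₂, ← prod.comp_lift, prod.lift_fst_snd, Category.comp_id]⟩
    exact ⟨(key p m).2 h₁, ⟨Fork.IsLimit.mk _ (fun s => (hs s).choose)
      (fun s => (hs s).choose_spec) (fun s l hl => by
        have : l ≫ prod.lift p m = (hs s).choose ≫ prod.lift p m :=
          hl.trans (hs s).choose_spec.symm
        refine h₂ _ _ _ ?_ ?_
        · simpa only [Category.assoc, prod.lift_fst] using congrArg (· ≫ prod.fst) this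
        · simpa only [Category.assoc, prod.lift_snd] using congrArg (· ≫ prod.snd) this)⟩⟩

/-- Maps into the glued classifier can be constructed pointwise. -/
lemma exists_lift_of_pointwise {J : Type w} [Category.{w} J] {E : Type u} [Category.{v} E]
    [HasFiniteLimits E] {T : Subobject.Classifier (J ⥤ E)} {W B : J ⥤ E} {p : W ⟶ T.Ω} {m : W ⟶ B}
    {k : B ⟶ T.Ω}
    (hmono : ∀ (d : J) (Z : E) (f g : Z ⟶ W.obj d),
      f ≫ p.app d = g ≫ p.app d → f ≫ m.app d = g ≫ m.app d → f = g)
    (hlift : ∀ (d : J) (Z : E) (a : Z ⟶ T.Ω.obj d) (b : Z ⟶ B.obj d),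
      a = prod.lift a (b ≫ k.app d) ≫ conjAt T d →
        ∃ l : Z ⟶ W.obj d, l ≫ p.app d = a ∧ l ≫ m.app d = b)
    {Y : J ⥤ E} (a : Y ⟶ T.Ω) (b : Y ⟶ B) (hab : prod.lift a (b ≫ k) ≫ conj T = a) :
    ∃ l : Y ⟶ W, l ≫ p = a ∧ l ≫ m = b := by
  choose l hl₁ hl₂ using fun d => hlift d _ (a.app d) (b.app d) (by
    rw [← NatTrans.comp_app, prod_lift_app_conjAt, hab])
  -- Naturality is forced by joint monicity of the components of `p` and `m`, which are themselves
  -- natural.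
  refine ⟨{ app := l, naturality := fun d d' k => hmono _ _ _ _ ?_ ?_ }, ?_, ?_⟩
  · rw [Category.assoc, Category.assoc, hl₁, a.naturality, p.naturality, ← hl₁, Category.assoc]
  · rw [Category.assoc, Category.assoc, hl₂, b.naturality, m.naturality, ← hl₂, Category.assoc]
  · ext d
    exact hl₁ d
  · ext d
    exact hl₂ d

namespace IteratedGluingData

variable {N : Type w} [SmallCategory N] [StrictInverseStructure N] (𝓘 : IteratedGluingData N)

lemma exists_inclInterior_or_inclBoundary {n : N} (y : 𝓘.stage.obj (op n)) :
    (∃ c, (𝓘.inclInterior n).obj c = y) ∨ ∃ d, (𝓘.inclBoundary n).obj d = y := by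
  have h : (𝓘.collageIso n).hom.toFunctor.obj ((𝓘.collageIso n).inv.toFunctor.obj y) = y :=
    Functor.congr_obj (congrArg Cat.Hom.toFunctor (𝓘.collageIso n).inv_hom_id) y
  generalize (𝓘.collageIso n).inv.toFunctor.obj y = x at h
  rcases x with c | d
  · exact Or.inl ⟨c, h⟩
  · exact Or.inr ⟨d, h⟩

variable {E : Type u} [Category.{w} E] {n : N}

/-- Natural transformations on a stage are constructed from natural transformations on the interior
and the boundary. -/
theorem exists_natTrans_stage {X Y : 𝓘.stage.obj (op n) ⥤ E}
    (a : 𝓘.inclInterior n ⋙ X ⟶ 𝓘.inclInterior n ⋙ Y)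
    (b : 𝓘.inclBoundary n ⋙ X ⟶ 𝓘.inclBoundary n ⋙ Y)
    (hab : ∀ (d : 𝓘.boundary n) (c : (𝓘.interior n).pt)
      (h : (𝓘.inclBoundary n).obj d ⟶ (𝓘.inclInterior n).obj c),
      X.map h ≫ a.app c = b.app d ≫ Y.map h) :
    ∃ σ : X ⟶ Y, Functor.whiskerLeft (𝓘.inclInterior n) σ = a ∧
      Functor.whiskerLeft (𝓘.inclBoundary n) σ = b := by
  let e := (𝓘.collageIso n).hom.toFunctor
  have he : e.IsEquivalence := (Cat.equivOfIso (𝓘.collageIso n)).isEquivalence_functor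
  let τ : e ⋙ X ⟶ e ⋙ Y :=
    { app := fun x => match x with
        | .ofC c => a.app c
        | .ofD d => b.app d
      naturality := fun x y f => by
        rcases x with c | d <;> rcases y with c' | d'
        · exact a.naturality (X := c) (Y := c') f
        · exact PEmpty.elim f
        · exact hab d c' (e.map f)
        · exact b.naturality (X := d) (Y := d') f }
  -- Objects can be split into cases only on the collage; precomposition with an equivalence is
  -- full, so `τ` comes from the stage.
  obtain ⟨σ, hσ⟩ := ((Functor.whiskeringLeft _ _ E).obj e).map_surjective τ
  refine ⟨σ, ?_, ?_⟩
  · ext c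
    exact NatTrans.congr_app hσ (.ofC c)
  · ext d
    exact NatTrans.congr_app hσ (.ofD d)

variable [HasFiniteLimits E] [𝓘.HasMatchingLimits E]

/-- The point of the matching object of a pointed functor. -/
noncomputable abbrev matchingPoint (G : (𝓘.interior n).pt ⥤ Under (⊤_ E)) :
    (𝓘.matchingFunctor E n).obj ((Functor.const _).obj (⊤_ E)) ⟶
      (𝓘.matchingFunctor E n).obj (unpoint G) :=
  (𝓘.matchingFunctor E n).map (point G)

instance {K : Type*} [Category K] (P : K ⥤ Under (⊤_ E)) (k : K) : Mono ((point P).app k) :=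
  terminalIsTerminal.mono_from _

instance (G : (𝓘.interior n).pt ⥤ Under (⊤_ E)) : Mono (𝓘.matchingPoint G) := by
  have : ∀ c, Mono ((point G).app c) := inferInstance
  have : Mono (point G) := NatTrans.mono_of_mono_app _
  -- A right adjoint preserves the monomorphism `point G`, and restriction to the boundary keeps it
  -- pointwise mono.
  have : ((𝓘.inclInterior n).ran (H := E)).IsRightAdjoint :=
    ((𝓘.inclInterior n).ranAdjunction E).isRightAdjoint
  have (d : 𝓘.boundary n) : Mono ((𝓘.matchingPoint G).app d) :=
    inferInstanceAs (Mono ((((𝓘.inclInterior n).ran (H := E)).map (point G)).app _))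
  exact NatTrans.mono_of_mono_app _

/-- A pointed functor on a stage is glued along a classifier `T` on the boundary if its values on
the boundary are the equalisers that compute the classifier of a glued category. -/
def IsGlued (T : Subobject.Classifier (𝓘.boundary n ⥤ E))
    (P : 𝓘.stage.obj (op n) ⥤ Under (⊤_ E)) : Prop :=
  ∃ p : 𝓘.inclBoundary n ⋙ unpoint P ⟶ T.Ω, ∀ i : 𝓘.boundary n,
    (∃ h : prod.lift (p.app i) (((𝓘.matchingMap E n).app (unpoint P)).app i) ≫ prod.fst =
        prod.lift (p.app i) (((𝓘.matchingMap E n).app (unpoint P)).app i) ≫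
          prod.map (𝟙 (T.Ω.obj i))
            ((T.χ (𝓘.matchingPoint (𝓘.inclInterior n ⋙ P))).app i) ≫ conjAt T i,
      Nonempty (IsLimit (Fork.ofι
        (prod.lift (p.app i) (((𝓘.matchingMap E n).app (unpoint P)).app i)) h))) ∧
    (point P).app ((𝓘.inclBoundary n).obj i) ≫ p.app i =
      (T.χ₀ ((Functor.const _).obj (⊤_ E))).app i ≫ T.truth.app i

/-- The matching map as a natural transformation between explicit functors. -/
noncomputable abbrev matchingMapApp (X : 𝓘.stage.obj (op n) ⥤ E) :
    𝓘.inclBoundary n ⋙ X ⟶ (𝓘.matchingFunctor E n).obj (𝓘.inclInterior n ⋙ X) :=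
  (𝓘.matchingMap E n).app X

omit [HasFiniteLimits E] in
lemma matchingMapApp_naturality {X Y : 𝓘.stage.obj (op n) ⥤ E} (φ : X ⟶ Y) :
    Functor.whiskerLeft (𝓘.inclBoundary n) φ ≫ 𝓘.matchingMapApp Y =
      𝓘.matchingMapApp X ≫
        (𝓘.matchingFunctor E n).map (Functor.whiskerLeft (𝓘.inclInterior n) φ) :=
  (𝓘.matchingMap E n).naturality φ

lemma matchingConst_hom_ext {d : 𝓘.boundary n} {Z : E}
    (f g : Z ⟶ ((𝓘.matchingFunctor E n).obj ((Functor.const _).obj (⊤_ E))).obj d) : f = g :=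
  𝓘.matchingProj_hom_ext (fun _ _ => terminal.hom_ext _ _)

/-- The map from a functor to the terminal functor. -/
@[simps]
noncomputable def toConstTerminal {K : Type*} [Category K] (F : K ⥤ E) :
    F ⟶ (Functor.const K).obj (⊤_ E) where
  app k := terminal.from _

/-- On the interior the characteristic map must be the given one, `a`. On the boundary it must have
components `χ m'` and `g`, the matching map of `X` followed by `M n a`. These satisfy the equaliser
condition because `g` is true on `U`, which gives existence; joint monicity gives uniqueness. -/
theorem IsGlued.isPointwiseClassifier {T : Subobject.Classifier (𝓘.boundary n ⥤ E)}
    {P : 𝓘.stage.obj (op n) ⥤ Under (⊤_ E)} (hP : 𝓘.IsGlued T P)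
    (hP' : IsPointwiseClassifier (𝓘.inclInterior n ⋙ P)) : IsPointwiseClassifier P := by
  obtain ⟨p, hp⟩ := hP
  let μ := 𝓘.matchingMapApp (unpoint P)
  let mt := 𝓘.matchingPoint (𝓘.inclInterior n ⋙ P)
  have heq (d) : p.app d = prod.lift (p.app d) (μ.app d ≫ (T.χ mt).app d) ≫ conjAt T d :=
    ((exists_isLimit_fork_iff _ _ _ _).1 (hp d).1).1
  have hmono (d : 𝓘.boundary n) (Z : E)
      (f g : Z ⟶ (unpoint P).obj ((𝓘.inclBoundary n).obj d)) :
      f ≫ p.app d = g ≫ p.app d → f ≫ μ.app d = g ≫ μ.app d → f = g :=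
    ((exists_isLimit_fork_iff _ _ _ _).1 (hp d).1).2.1 Z f g
  have hlift := fun d => ((exists_isLimit_fork_iff _ _ _ _).1 (hp d).1).2.2
  have hpt (d) : (point P).app ((𝓘.inclBoundary n).obj d) ≫ p.app d =
      (T.χ₀ ((Functor.const _).obj (⊤_ E))).app d ≫ T.truth.app d := (hp d).2
  have hμpt : Functor.whiskerLeft (𝓘.inclBoundary n) (point P) ≫ μ =
      𝓘.matchingMapApp ((Functor.const _).obj (⊤_ E)) ≫ mt :=
    𝓘.matchingMapApp_naturality (point P)
  -- maps into `Ω` which are true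
  have hpt' (d) {Z : E} (f : Z ⟶ (unpoint P).obj ((𝓘.inclBoundary n).obj d))
      (r : Z ⟶ T.Ω₀.obj d) (t : Z ⟶ _) (h₁ : f ≫ p.app d = r ≫ T.truth.app d)
      (h₂ : f ≫ μ.app d = t ≫ mt.app d) :
      f = terminal.from Z ≫ (point P).app ((𝓘.inclBoundary n).obj d) := by
    refine hmono d _ _ _ ?_ ?_
    · rw [Category.assoc, hpt, h₁, ← Category.assoc]
      congr 1
      exact (isTerminalΩ₀Obj T d).hom_ext _ _
    · have := NatTrans.congr_app hμpt d
      dsimp only [NatTrans.comp_app, Functor.whiskerLeft_app] at this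
      rw [Category.assoc, this, h₂, ← Category.assoc]
      congr 1
      exact 𝓘.matchingConst_hom_ext _ _
  intro U X m hm
  obtain ⟨a, ha, hau⟩ := hP' (Functor.whiskerLeft (𝓘.inclInterior n) m) (fun c => hm _)
  let m' := Functor.whiskerLeft (𝓘.inclBoundary n) m
  have hm'' (d) : Mono (m'.app d) := hm _
  have hm' : Mono m' := NatTrans.mono_of_mono_app _
  let g := 𝓘.matchingMapApp X ≫ (𝓘.matchingFunctor E n).map a
  have hg : m' ≫ g = (𝓘.matchingMapApp U ≫ (𝓘.matchingFunctor E n).map (toConstTerminal _)) ≫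
      mt := by
    have h1 : Functor.whiskerLeft (𝓘.inclInterior n) m ≫ a =
        toConstTerminal _ ≫ point (𝓘.inclInterior n ⋙ P) := by
      ext c
      exact (ha c).w
    rw [← Category.assoc, 𝓘.matchingMapApp_naturality m, Category.assoc, Category.assoc,
      ← Functor.map_comp, h1, Functor.map_comp]
  obtain ⟨b, hb₁, hb₂⟩ := exists_lift_of_pointwise hmono hlift (T.χ m') g
    (χ_conj_eq_χ T m' _ (by
      rw [← Category.assoc, hg, Category.assoc, (T.isPullback mt).w, ← Category.assoc]
      congr 1
      exact Subsingleton.elim _ _))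
  -- On a map from the boundary to the interior, both functors act through their matching maps
  -- followed by a projection, so compatibility is `b ≫ μ = g` read off at that projection.
  obtain ⟨σ, hσ₁, hσ₂⟩ := 𝓘.exists_natTrans_stage a b (fun d c h => by
    have h1 := NatTrans.congr_app hb₂ d
    rw [NatTrans.comp_app] at h1
    have h2 := 𝓘.matchingMap_matchingProj (unpoint P) h
    have h3 := 𝓘.map_matchingProj a h
    rw [← h2, ← Category.assoc, h1, NatTrans.comp_app, Category.assoc]
    refine Eq.trans ?_ (congrArg (_ ≫ ·) h3.symm)
    rw [← Category.assoc]
    exact congrArg (· ≫ a.app c) (𝓘.matchingMap_matchingProj X h).symm)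
  refine ⟨σ, fun k => ?_, fun σ' hσ' => ?_⟩
  · obtain ⟨c, rfl⟩ | ⟨d, rfl⟩ := 𝓘.exists_inclInterior_or_inclBoundary k
    · have := ha c
      rwa [← hσ₁] at this
    · have h1 := NatTrans.congr_app hb₁ d
      rw [← hσ₂] at h1
      have h2 := NatTrans.congr_app hb₂ d
      rw [← hσ₂] at h2
      have h3 := (T.isPullback m').app d
      refine isPullback_of_exists_lift ?_ (fun Z z r hz => ?_)
      · refine hpt' d _ ((T.χ₀ (𝓘.inclBoundary n ⋙ U)).app d) ((𝓘.matchingMapApp U ≫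
          (𝓘.matchingFunctor E n).map (toConstTerminal _)).app d) ?_ ?_
        · exact (Category.assoc _ _ _).trans ((congrArg _ h1).trans h3.w)
        · exact (Category.assoc _ _ _).trans ((congrArg _ h2).trans (NatTrans.congr_app hg d))
      · have h4 : z ≫ (T.χ m').app d =
            (r ≫ (T.χ₀ ((Functor.const _).obj (⊤_ E))).app d) ≫ T.truth.app d := by
          rw [Category.assoc, ← hpt, ← h1, ← Category.assoc r, ← hz, Category.assoc]
          rfl
        exact ⟨h3.lift _ _ h4, h3.lift_fst _ _ _⟩
  · have h1 : Functor.whiskerLeft (𝓘.inclInterior n) σ' = a := hau _ (fun c => hσ' _)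
    -- The first component of any other characteristic map also classifies `m'`: since `p` lies
    -- below the truth of `μ`, wherever `p` is true so is `μ`, and by `hpt'` the value is then the
    -- point of `Ω`.
    have h2 : Functor.whiskerLeft (𝓘.inclBoundary n) σ' ≫ p = T.χ m' := by
      refine T.uniq m' (χ₀' := T.χ₀ _) (IsPullback.of_forall_isPullback_app (fun d =>
        isPullback_of_exists_lift ?_ (fun Z z r hz => ?_)))
      · have h3 := (hσ' ((𝓘.inclBoundary n).obj d)).w
        refine ((Category.assoc _ _ _).symm.trans (congrArg (· ≫ p.app d) h3)).trans ?_
        rw [Category.assoc, hpt, ← Category.assoc]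
        congr 1
        exact (isTerminalΩ₀Obj T d).hom_ext _ _
      · let f : Z ⟶ (unpoint P).obj ((𝓘.inclBoundary n).obj d) :=
          z ≫ σ'.app ((𝓘.inclBoundary n).obj d)
        have hf : f ≫ p.app d = r ≫ T.truth.app d := (Category.assoc _ _ _).trans hz
        have h4 : (f ≫ μ.app d) ≫ (T.χ mt).app d = r ≫ T.truth.app d := by
          refine (eq_truth_of_conjAt T d (f ≫ p.app d) _ r ?_).2
          rw [Category.assoc f, ← prod.comp_lift, Category.assoc, ← heq, hf]
        have h5 := (T.isPullback mt).app d
        have h6 := hpt' d f r (h5.lift _ _ h4) hf (h5.lift_fst _ _ h4).symm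
        exact ⟨(hσ' ((𝓘.inclBoundary n).obj d)).lift _ _ h6,
          (hσ' ((𝓘.inclBoundary n).obj d)).lift_fst _ _ _⟩
    have h3 : Functor.whiskerLeft (𝓘.inclBoundary n) σ' ≫ μ = g := by
      rw [𝓘.matchingMapApp_naturality σ', h1]
    ext k
    obtain ⟨c, rfl⟩ | ⟨d, rfl⟩ := 𝓘.exists_inclInterior_or_inclBoundary k
    · exact NatTrans.congr_app (h1.trans hσ₁.symm) c
    · refine hmono d _ _ _ ?_ ?_
      · exact NatTrans.congr_app (h2.trans ((congrArg (· ≫ p) hσ₂).trans hb₁).symm) d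
      · exact NatTrans.congr_app (h3.trans ((congrArg (· ≫ μ) hσ₂).trans hb₂).symm) d

end IteratedGluingData

/-! ### Construction of glued pointed functors -/

/-- The equaliser of `fst` and `∧ ∘ (id × k)` in a functor category, described pointwise. -/
lemma exists_pointwise_equalizer {J : Type w} [Category.{w} J] {E : Type u} [Category.{v} E]
    [HasFiniteLimits E] (T : Subobject.Classifier (J ⥤ E)) {B : J ⥤ E} (k : B ⟶ T.Ω) :
    ∃ (W : J ⥤ E) (p : W ⟶ T.Ω) (m : W ⟶ B),
      (∀ d, p.app d = prod.lift (p.app d) (m.app d ≫ k.app d) ≫ conjAt T d) ∧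
      (∀ (d : J) (Z : E) (f g : Z ⟶ W.obj d),
        f ≫ p.app d = g ≫ p.app d → f ≫ m.app d = g ≫ m.app d → f = g) ∧
      ∀ (d : J) (Z : E) (a : Z ⟶ T.Ω.obj d) (b : Z ⟶ B.obj d),
        a = prod.lift a (b ≫ k.app d) ≫ conjAt T d →
          ∃ l : Z ⟶ W.obj d, l ≫ p.app d = a ∧ l ≫ m.app d = b := by
  let s : T.Ω ⨯ B ⟶ T.Ω := prod.map (𝟙 T.Ω) k ≫ conj T
  let i := equalizer.ι (prod.fst : T.Ω ⨯ B ⟶ T.Ω) s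
  refine ⟨_, i ≫ prod.fst, i ≫ prod.snd, fun d => ?_, fun d Z f g h₁ h₂ => ?_,
    fun d Z a b hab => ?_⟩
  · rw [← NatTrans.comp_app, prod_lift_app_conjAt]
    congr 1
    have : i ≫ prod.fst = i ≫ s := equalizer.condition _ _
    rw [this]
    have h : prod.lift (i ≫ s) ((i ≫ prod.snd) ≫ k) = i ≫ prod.map (𝟙 T.Ω) k := by
      rw [← this]
      apply prod.hom_ext
      · rw [prod.lift_fst, Category.assoc, prod.map_fst, Category.comp_id]
      · rw [prod.lift_snd, Category.assoc, Category.assoc, prod.map_snd]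
    rw [h, Category.assoc]
  · have : Mono (i.app d) := inferInstance
    rw [← cancel_mono (i.app d)]
    apply prod_obj_hom_ext
    · simpa using h₁
    · simpa using h₂
  · let z := prod.lift a b ≫ (PreservesLimitPair.iso ((evaluation J E).obj d) T.Ω B).inv
    have hz : z ≫ (prod.fst : T.Ω ⨯ B ⟶ T.Ω).app d = z ≫ s.app d := by
      have h : z ≫ (prod.map (𝟙 T.Ω) k).app d = prod.lift a (b ≫ k.app d) ≫
          (PreservesLimitPair.iso ((evaluation J E).obj d) T.Ω T.Ω).inv := by
        apply prod_obj_hom_ext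
        · rw [prod_lift_comp_inv_fst, Category.assoc, ← NatTrans.comp_app, prod.map_fst,
            Category.comp_id]
          exact prod_lift_comp_inv_fst d a b
        · rw [prod_lift_comp_inv_snd, Category.assoc, ← NatTrans.comp_app, prod.map_snd,
            NatTrans.comp_app, ← Category.assoc]
          exact congrArg (· ≫ k.app d) (prod_lift_comp_inv_snd d a b)
      refine (prod_lift_comp_inv_fst d a b).trans (hab.trans ?_)
      rw [NatTrans.comp_app, ← Category.assoc z, h, Category.assoc]
      rfl
    have hl := isLimitForkMapOfIsLimit ((evaluation J E).obj d)
      (equalizer.condition (prod.fst : T.Ω ⨯ B ⟶ T.Ω) s) (equalizerIsEqualizer _ _)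
    have h1 := Fork.IsLimit.lift_ι' hl z hz
    refine ⟨Fork.IsLimit.lift hl z hz, ?_, ?_⟩
    · rw [NatTrans.comp_app, ← Category.assoc]
      exact (congrArg (· ≫ _) h1).trans (prod_lift_comp_inv_fst d a b)
    · rw [NatTrans.comp_app, ← Category.assoc]
      exact (congrArg (· ≫ _) h1).trans (prod_lift_comp_inv_snd d a b)

namespace IteratedGluingData

variable {N : Type w} [SmallCategory N] [StrictInverseStructure N] (𝓘 : IteratedGluingData N)
  {E : Type u} [Category.{w} E] {n : N} [HasFiniteLimits E] [𝓘.HasMatchingLimits E]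

/-- A functor on the collage given by functors on the interior and on the boundary, and a map from
the latter to the matching object of the former. -/
noncomputable def collageFunctor (G : (𝓘.interior n).pt ⥤ Under (⊤_ E)) {W : 𝓘.boundary n ⥤ E}
    (t : (Functor.const _).obj (⊤_ E) ⟶ W) (m : W ⟶ (𝓘.matchingFunctor E n).obj (unpoint G))
    (s : (Functor.const _).obj (⊤_ E) ⟶
      (𝓘.matchingFunctor E n).obj ((Functor.const _).obj (⊤_ E)))
    (hs : t ≫ m = s ≫ 𝓘.matchingPoint G) :
    Collage (𝓘.attach n) ⥤ Under (⊤_ E) where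
  obj
    | .ofC c => G.obj c
    | .ofD d => Under.mk (t.app d)
  map {x y} f := match x, y, f with
    | .ofC c, .ofC c', f => G.map (X := c) (Y := c') f
    | .ofC _, .ofD _, f => PEmpty.elim f
    | .ofD d, .ofC c, f => Under.homMk (m.app d ≫ 𝓘.matchingProj (unpoint G) (d := d) (c := c)
        ((𝓘.collageIso n).hom.toFunctor.map f)) (by
          have h := NatTrans.congr_app hs d
          rw [NatTrans.comp_app, NatTrans.comp_app] at h
          refine (Category.assoc _ _ _).symm.trans ((congrArg (· ≫ _) h).trans ?_)
          refine (Category.assoc _ _ _).trans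
            ((congrArg (_ ≫ ·) (𝓘.map_matchingProj (point G) _)).trans ?_)
          rw [← Category.assoc, ← Category.id_comp (G.obj c).hom]
          exact congrArg (· ≫ (G.obj c).hom) (terminal.hom_ext _ _))
    | .ofD d, .ofD d', f => Under.homMk (W.map (X := d) (Y := d') f)
        ((t.naturality (X := d) (Y := d') f).symm.trans (Category.id_comp _))
  map_id x := by
    rcases x with c | d
    · exact G.map_id c
    · ext
      exact W.map_id d
  map_comp {x y z} f g := by
    rcases x with c | d <;> rcases y with c' | d' <;> rcases z with c'' | d''
    · exact G.map_comp (X := c) (Y := c') (Z := c'') f g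
    · exact PEmpty.elim g
    · exact PEmpty.elim f
    · exact PEmpty.elim f
    · ext
      refine (congrArg (fun h => m.app d ≫ 𝓘.matchingProj (unpoint G) (d := d) (c := c'') h)
        ((𝓘.collageIso n).hom.toFunctor.map_comp f g)).trans ?_
      refine (congrArg (m.app d ≫ ·) (𝓘.matchingProj_map (unpoint G) (d := d) (c := c') (c' := c'')
        ((𝓘.collageIso n).hom.toFunctor.map f) g).symm).trans ?_
      exact (Category.assoc _ _ _).symm
    · exact PEmpty.elim g
    · ext
      refine (congrArg (fun h => m.app d ≫ 𝓘.matchingProj (unpoint G) (d := d) (c := c'') h)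
        ((𝓘.collageIso n).hom.toFunctor.map_comp f g)).trans ?_
      refine (congrArg (m.app d ≫ ·) (𝓘.obj_map_matchingProj (unpoint G) (d := d) (d' := d') f
        (c := c'') ((𝓘.collageIso n).hom.toFunctor.map g)).symm).trans ?_
      refine (Category.assoc _ _ _).symm.trans ?_
      exact (congrArg (· ≫ _) (m.naturality (X := d) (Y := d') f).symm).trans
        (Category.assoc _ _ _)
    · ext
      exact W.map_comp (X := d) (Y := d') (Z := d'') f g

/-- The boundary values are the equalisers, and a map from the boundary to the interior acts by the
second component `m` followed by the matching projection. This choice forces `m` to be the matching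
map. -/
lemma exists_collageFunctor (T : Subobject.Classifier (𝓘.boundary n ⥤ E))
    (G : (𝓘.interior n).pt ⥤ Under (⊤_ E)) :
    ∃ P : Collage (𝓘.attach n) ⥤ Under (⊤_ E), Collage.inclC _ ⋙ P = G ∧
      ∃ (p : Collage.inclD _ ⋙ unpoint P ⟶ T.Ω) (m : Collage.inclD _ ⋙ unpoint P ⟶
          (𝓘.matchingFunctor E n).obj (unpoint (Collage.inclC _ ⋙ P))),
        (∀ d, p.app d = prod.lift (p.app d)
          (m.app d ≫ (T.χ (𝓘.matchingPoint (Collage.inclC _ ⋙ P))).app d) ≫ conjAt T d) ∧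
        (∀ (d : 𝓘.boundary n) (Z : E) (f g : Z ⟶ (unpoint P).obj (.ofD d)),
          f ≫ p.app d = g ≫ p.app d → f ≫ m.app d = g ≫ m.app d → f = g) ∧
        (∀ (d : 𝓘.boundary n) (Z : E) (a : Z ⟶ T.Ω.obj d) (b : Z ⟶ _),
          a = prod.lift a (b ≫ (T.χ (𝓘.matchingPoint (Collage.inclC _ ⋙ P))).app d) ≫
            conjAt T d → ∃ l : Z ⟶ (unpoint P).obj (.ofD d), l ≫ p.app d = a ∧ l ≫ m.app d = b) ∧
        (∀ d, (point P).app (.ofD d) ≫ p.app d =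
          (T.χ₀ ((Functor.const _).obj (⊤_ E))).app d ≫ T.truth.app d) ∧
        ∀ (d : 𝓘.boundary n) (c : (𝓘.interior n).pt)
          (f : (Collage.ofD d : Collage (𝓘.attach n)) ⟶ Collage.ofC c),
          m.app d ≫ 𝓘.matchingProj _ (d := d) (c := c)
            ((𝓘.collageIso n).hom.toFunctor.map f) = (unpoint P).map f := by
  let mt := 𝓘.matchingPoint G
  obtain ⟨W, p, m, h₁, h₂, h₃⟩ := exists_pointwise_equalizer T (T.χ mt)
  let s : (Functor.const (𝓘.boundary n)).obj (⊤_ E) ⟶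
      (𝓘.matchingFunctor E n).obj ((Functor.const _).obj (⊤_ E)) :=
    𝓘.matchingMapApp ((Functor.const _).obj (⊤_ E))
  -- The point is the pair (true, `M n` true); it lies in the equaliser since `χ mt` is true on `mt`
  -- and true ∧ true = true.
  obtain ⟨t, ht₁, ht₂⟩ := exists_lift_of_pointwise h₂ h₃
    (T.χ₀ ((Functor.const _).obj (⊤_ E)) ≫ T.truth) (s ≫ mt) (by
      rw [Category.assoc, (T.isPullback mt).w, ← Category.assoc,
        Subsingleton.elim (s ≫ T.χ₀ _) (T.χ₀ _), ← prod.comp_lift, Category.assoc,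
        truth_conj_truth])
  exact ⟨𝓘.collageFunctor G t m s ht₂, rfl, p, m, h₁, h₂, h₃,
    fun d => NatTrans.congr_app ht₁ d, fun d c f => rfl⟩

theorem exists_isGlued (T : Subobject.Classifier (𝓘.boundary n ⥤ E))
    (G : (𝓘.interior n).pt ⥤ Under (⊤_ E)) :
    ∃ P : 𝓘.stage.obj (op n) ⥤ Under (⊤_ E), 𝓘.inclInterior n ⋙ P = G ∧ 𝓘.IsGlued T P := by
  obtain ⟨P', hG, p, m, h₁, h₂, h₃, h₄, h₅⟩ := 𝓘.exists_collageFunctor T G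
  let e := (𝓘.collageIso n).hom.toFunctor
  have he : e.IsEquivalence := (Cat.equivOfIso (𝓘.collageIso n)).isEquivalence_functor
  -- `e` is an isomorphism of categories, so the factorisation is strict, as the equality with `G`
  -- requires.
  obtain ⟨P, rfl⟩ : ∃ P, P' = e ⋙ P :=
    ⟨(𝓘.collageIso n).inv.toFunctor ⋙ P', congrArg (· ⋙ P')
      (congrArg Cat.Hom.toFunctor (𝓘.collageIso n).hom_inv_id).symm⟩
  subst hG
  have hm : m = 𝓘.matchingMapApp (unpoint P) := by
    ext d
    refine 𝓘.matchingProj_hom_ext (fun c h => ?_)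
    obtain ⟨f, rfl⟩ : ∃ f : (Collage.ofD d : Collage (𝓘.attach n)) ⟶ Collage.ofC c,
        e.map f = h := e.map_surjective h
    exact (h₅ d c f).trans (𝓘.matchingMap_matchingProj (unpoint P) _).symm
  subst hm
  exact ⟨P, rfl, p, fun i => ⟨(exists_isLimit_fork_iff _ _ _ _).2 ⟨h₁ i, h₂ i, h₃ i⟩, h₄ i⟩⟩

end IteratedGluingData

/-! ### The theorem -/

namespace IteratedGluingData

variable {N : Type w} [SmallCategory N] [StrictInverseStructure N] (𝓘 : IteratedGluingData N)
  {E : Type u} [Category.{w} E] [HasFiniteLimits E] [𝓘.HasMatchingLimits E]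

/-- A pointed functor on the colimit of the stages is a pointwise classifier if all of its
restrictions to the stages are glued. -/
theorem isPointwiseClassifier_of_isGlued {c : Cocone 𝓘.stage} (hc : IsColimit c)
    (T : ∀ n : N, Subobject.Classifier (𝓘.boundary n ⥤ E)) {P : c.pt ⥤ Under (⊤_ E)}
    (hP : ∀ n, 𝓘.IsGlued (T n) ((c.ι.app (op n)).toFunctor ⋙ P)) : IsPointwiseClassifier P := by
  have wf : WellFounded (fun m n : N => GeneralisedInverseStructure.deg m <
      GeneralisedInverseStructure.deg n) := (measure GeneralisedInverseStructure.deg).wf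
  have h (n : N) : IsPointwiseClassifier ((c.ι.app (op n)).toFunctor ⋙ P) := by
    induction n using wf.induction with
    | _ n ih =>
    refine IsGlued.isPointwiseClassifier 𝓘 (hP n)
      -- The legs of the interior come from stages of strictly lower degree, where the induction
      -- hypothesis applies.
      (.of_isColimit (𝓘.isColimitInterior n) (fun x => ?_))
    have hx : 𝓘.interiorLeg n x ⋙ 𝓘.inclInterior n ⋙ (c.ι.app (op n)).toFunctor ⋙ P =
        (c.ι.app (op x.unop.1)).toFunctor ⋙ P := by
      rw [← Functor.assoc, interiorLeg_comp_inclInterior, ← Functor.assoc, CatColimit.cocone_w]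
    exact hx ▸ ih x.unop.1 (deg_lt_of_not_isIdentity x.unop.2.1 x.unop.2.2)
  exact .of_isColimit hc (fun n => h n.unop)

end IteratedGluingData

theorem mainTheorem3 {N : Type w} [SmallCategory N] [StrictInverseStructure N]
    (𝓘 : IteratedGluingData N)
    (Iinf : Cocone 𝓘.stage) (hIinf : IsColimit Iinf)
    (E : Type u) [Category.{w} E] [HasFiniteLimits E] [𝓘.HasMatchingLimits E]
    (Ωbar : ∀ n : N, Subobject.Classifier (𝓘.boundary n ⥤ E)) :
    ∃ (T : Subobject.Classifier (Iinf.pt ⥤ E))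
      (p : ∀ n : N, (𝓘.resBoundary E n).obj ((𝓘.resStage E Iinf n).obj T.Ω) ⟶ (Ωbar n).Ω),
      ∀ (n : N) (i : 𝓘.boundary n),
        -- the map from `Ω [i]` to the product
        let ι := prod.lift ((p n).app i)
          (((𝓘.matchingMap E n).app ((𝓘.resStage E Iinf n).obj T.Ω)).app i)
        -- the truth map at `[i]`
        let trueAt := ((𝓘.resBoundary E n).map ((𝓘.resStage E Iinf n).map T.truth)).app i
        (∃ h : ι ≫ prod.fst =
            ι ≫ prod.map (𝟙 ((Ωbar n).Ω.obj i)) (((Ωbar n).χ (𝓘.matchingTruth E Iinf T n)).app i) ≫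
              conjAt (Ωbar n) i,
          Nonempty (IsLimit (Fork.ofι ι h))) ∧
        trueAt ≫ ι ≫ prod.fst =
          ((Ωbar n).χ₀ _).app i ≫ (Ωbar n).truth.app i ∧
        trueAt ≫ ι ≫ prod.snd =
          ((𝓘.matchingMap E n).app ((𝓘.resStage E Iinf n).obj T.Ω₀)).app i ≫
            (𝓘.matchingTruth E Iinf T n).app i := by
  choose extend hextend hglued using fun n => 𝓘.exists_isGlued (Ωbar n)
  have : Nonempty (Under (⊤_ E)) := ⟨Under.mk (𝟙 _)⟩
  obtain ⟨P, hP⟩ := 𝓘.exists_functor_of_extend hIinf extend hextend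
  have hP' (n : N) : 𝓘.IsGlued (Ωbar n) ((Iinf.ι.app (op n)).toFunctor ⋙ P) := by
    obtain ⟨G, hG⟩ := hP n
    rw [hG]
    exact hglued n G
  choose p hp using hP'
  -- The classifier has `unpoint P` and `point P` as its object and truth map by definition, so the
  -- equaliser and the value of `p` on truth are those recorded by `IsGlued`; the last claim is
  -- naturality of the matching map.
  refine ⟨(𝓘.isPointwiseClassifier_of_isGlued hIinf Ωbar (fun n => ⟨p n, hp n⟩)).classifier, p,
    fun n i => ⟨(hp n i).1, ?_, ?_⟩⟩
  · rw [prod.lift_fst]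
    exact (hp n i).2
  · rw [prod.lift_snd]
    exact NatTrans.congr_app (𝓘.matchingMapApp_naturality
      (point ((Iinf.ι.app (op n)).toFunctor ⋙ P))) i
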